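/- Let $E$ be a nonzero real Banach space with dual $E^*$ and pairing $\langle x,x^*\rangle := x^*(x)$. Let $S\colon E\rightrightarrows E^*$ be a multifunction with graph $G(S)=\{(s,s^*)\in E\times E^*: s^*\in S(s)\}$. Suppose that - $S$ is closed: $G(S)$ is norm-closed in $E\times E^*$; - $S$ is monotone: $\langle s-t,s^*-t^*\rangle\ge 0$ for all $(s,s^*),(t,t^*)\in G(S)$; - $S$ is quasidense: for all $(x,x^*)\in E\times E^*$, $$\inf_{(s,s^*)\in G(S)}\Big[\tfrac12\|s-x\|^2+\tfrac12\|s^*-x^*\|^2+\langle s-x,s^*-x^*\rangle\Big]\le 0$$ (with $\inf\emptyset=+\infty$, so that in particular $G(S)\ne\emptyset$). Then the following two statements hold. 1. Whenever $w\in E$ and $\widetilde W$ is a nonempty weak$^*$-compact (that is, $\sigma(E^*,E)$-compact) convex subset of $E^*$ such that $$\max_{v^*\in\widetilde W}\langle s-w,s^*-v^*\rangle\ge 0\quad\text{for all }(s,s^*)\in G(S),$$ one has $S(w)\cap\widetilde W\ne\emptyset$. 2. Whenever $W$ is a nonempty weakly compact (that is, $\sigma(E,E^*)$-compact) convex subset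 of $E$ and $w^*\in E^*$ are such that $$\max_{v\in W}\langle s-v,s^*-w^*\rangle\ge 0\quad\text{for all }(s,s^*)\in G(S),$$ one has $w^*\in S(W):=\bigcup_{v\in W}S(v)$. -/

import Mathlib

namespace Multifunction

variable {E : Type*} [NormedAddCommGroup E] [NormedSpace ℝ E]

/-- The graph `G(S)` of a multifunction `S : E ⇉ E*`. -/
def graph (S : E → Set (StrongDual ℝ E)) : Set (E × StrongDual ℝ E) :=
  {p | p.2 ∈ S p.1}

/-- `S` is closed: its graph is closed for the product of the norm topologies. -/
def IsClosedGraph (S : E → Set (StrongDual ℝ E)) : Prop :=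
  IsClosed (graph S)

/-- `S` is monotone: `⟨s - t, s* - t*⟩ ≥ 0` for all `(s, s*), (t, t*) ∈ G(S)`. -/
def IsMonotone (S : E → Set (StrongDual ℝ E)) : Prop :=
  ∀ p ∈ graph S, ∀ q ∈ graph S, 0 ≤ (p.2 - q.2) (p.1 - q.1)

/-- `S` is quasidense: for all `(x, x*)`, the infimum over `(s, s*) ∈ G(S)` of
`½‖s - x‖² + ½‖s* - x*‖² + ⟨s - x, s* - x*⟩` is at most `0`. The infimum is taken in the
extended reals, so that it is `+∞` when the graph is empty. -/
def IsQuasidense (S : E → Set (StrongDual ℝ E)) : Prop :=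
  ∀ (x : E) (x' : StrongDual ℝ E),
    (⨅ p ∈ graph S,
      ((1 / 2 * ‖p.1 - x‖ ^ 2 + 1 / 2 * ‖p.2 - x'‖ ^ 2 + (p.2 - x') (p.1 - x) : ℝ) : EReal)) ≤ 0

end Multifunction

/-! Both statements are one result about a bounded `J : Y → X*`: with `J` the identity of `E*` for
(1) and the embedding `E → E**` for (2), and `w` or `w*` translated to `0`, some `(0, v)` with `v ∈
W` is monotonically related to `G`. A closed quasidense graph contains every such point
(`IsQuasidense.mem_graph`). To find `v`, Fenchel duality (`exists_mem_convexHull_le`) produces an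
almost optimal point in the convex hull of `G` lifted by the pairing. The dual side is controlled by
the negative infimum property of quasidense sets (`IsQuasidense.exists_bidual_le`). Quasidensity and
monotonicity replace the hull point by a nearby point of `G`, and the hypothesis on `W` forces that
point close to `{0} × W` (`exists_mem_norm_le`). Weak* compactness then yields a limit `v`. -/

open Set Filter Topology

/-! ### Weak* separation of a compact convex set from a ball -/

/-- Dual bound: if `h x + ½‖x‖² + β ≥ y x` for all `x`, where `h` is the support function of `-K`,
then the distance from `-y` to the weak-* compact convex set `K` is controlled by `β`. -/
theorem exists_half_sq_norm_add_le {X : Type*} [NormedAddCommGroup X] [NormedSpace ℝ X]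
    {K : Set (StrongDual ℝ X)} (hconv : Convex ℝ K)
    (hcomp : IsCompact (StrongDual.toWeakDual '' K)) (y : StrongDual ℝ X) {β δ : ℝ} (hδ : 0 < δ)
    (h : ∀ x, ∃ v ∈ K, (y + v) x ≤ 1 / 2 * ‖x‖ ^ 2 + β) :
    ∃ v ∈ K, 1 / 2 * ‖y + v‖ ^ 2 ≤ β + δ := by
  have hβ : 0 ≤ β := by
    obtain ⟨v, -, hv⟩ := h 0
    simpa using hv
  set r := √(2 * (β + δ)) with hr
  have hrpos : 0 < r := Real.sqrt_pos.2 (by linarith)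
  have hrsq : r ^ 2 = 2 * (β + δ) := Real.sq_sqrt (by linarith)
  by_contra! hcon
  have hdisj : Disjoint (StrongDual.toWeakDual '' K)
      (WeakDual.toStrongDual ⁻¹' Metric.closedBall (-y) r) := by
    rw [Set.disjoint_left]
    rintro _ ⟨v, hv, rfl⟩ hmem
    have h1 : ‖y + v‖ ≤ r := by
      have := mem_closedBall_iff_norm.1 hmem
      rwa [StrongDual.toStrongDual_toWeakDual, sub_neg_eq_add, add_comm] at this
    have h2 := hcon v hv
    have h3 : ‖y + v‖ ^ 2 ≤ r ^ 2 := by gcongr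
    linarith
  have : LocallyConvexSpace ℝ (WeakDual ℝ X) :=
    inferInstanceAs (LocallyConvexSpace ℝ (WeakBilin (topDualPairing ℝ X)))
  obtain ⟨f, a, c, hfa, hac, hfc⟩ := geometric_hahn_banach_compact_closed
    (hconv.linear_image (StrongDual.toWeakDual (𝕜 := ℝ) (E := X)).toLinearMap) hcomp
    ((convex_closedBall (-y) r).linear_preimage (WeakDual.toStrongDual (𝕜 := ℝ) (E := X)).toLinearMap)
    (WeakDual.isClosed_closedBall (-y) r) hdisj
  obtain ⟨x, hx⟩ : ∃ x : X, ∀ φ : StrongDual ℝ X, f (StrongDual.toWeakDual φ) = φ x := by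
    obtain ⟨x, hx⟩ := LinearMap.dualEmbedding_surjective (topDualPairing ℝ X) f
    exact ⟨x, fun φ => (DFunLike.congr_fun hx (StrongDual.toWeakDual φ)).symm⟩
  have hK : ∀ v ∈ K, v x < a := fun v hv => by
    simpa [hx] using hfa _ (mem_image_of_mem _ hv)
  have hball : ∀ φ : StrongDual ℝ X, ‖φ‖ ≤ r → c < (φ - y) x := fun φ hφ => by
    rw [← hx]
    refine hfc _ ?_
    simpa [mem_closedBall_iff_norm] using hφ
  obtain ⟨g, hg1, hgx⟩ := exists_dual_vector'' ℝ x
  have hg : c < -(r * ‖x‖) - y x := by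
    have := hball (-(r • g)) (by
      rw [norm_neg, norm_smul, Real.norm_of_nonneg hrpos.le]
      nlinarith)
    simpa [hgx] using this
  have hxpos : 0 < ‖x‖ := by
    rw [norm_pos_iff]
    rintro rfl
    obtain ⟨v, hv, -⟩ := h 0
    have h1 := hK v hv
    have h2 := hball 0 (by simpa using hrpos.le)
    simp at h1 h2
    linarith
  -- At this vector of norm `r` the left side exceeds `r² = 2β + 2δ`, while the right side is `2β +
  -- δ`.
  obtain ⟨v, hv, hvx⟩ := h (-(r / ‖x‖) • x)
  have hn : ‖-(r / ‖x‖) • x‖ = r := by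
    rw [norm_smul, norm_neg, Real.norm_of_nonneg (by positivity)]
    field_simp
  rw [hn, map_smul, smul_eq_mul, add_apply] at hvx
  have h1 : y x + v x < -(r * ‖x‖) := by linarith [hK v hv]
  have h2 : r ^ 2 < -(r / ‖x‖) * (y x + v x) := by
    have : r / ‖x‖ * (r * ‖x‖) < r / ‖x‖ * (-(y x + v x)) := by
      have : 0 < r / ‖x‖ := by positivity
      gcongr; linarith
    have h3 : r / ‖x‖ * (r * ‖x‖) = r ^ 2 := by field_simp
    linarith
  linarith

/-! ### Monotonicity on the convex hull of the lifted graph -/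

theorem pairing_le_of_mem_convexHull {X Y : Type*} [NormedAddCommGroup X] [NormedSpace ℝ X]
    [NormedAddCommGroup Y] [NormedSpace ℝ Y] (J : Y →L[ℝ] StrongDual ℝ X) {G : Set (X × Y)}
    {x : X} {y : Y} {c : ℝ} (h : ∀ p ∈ G, J y p.1 + J p.2 x ≤ J p.2 p.1 + c)
    {z : X × Y × ℝ} (hz : z ∈ convexHull ℝ ((fun p : X × Y => (p.1, p.2, J p.2 p.1)) '' G)) :
    J y z.1 + J z.2.1 x ≤ z.2.2 + c := by
  refine convexHull_min (t := {z : X × Y × ℝ | J y z.1 + J z.2.1 x ≤ z.2.2 + c}) ?_ ?_ hz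
  · rintro _ ⟨p, hp, rfl⟩
    exact h p hp
  · intro z hz z' hz' a b ha hb hab
    simp only [mem_ofPred_eq] at hz hz' ⊢
    simp only [Prod.fst_add, Prod.snd_add, Prod.smul_fst, Prod.smul_snd, map_add, map_smul,
      add_apply, smul_apply, smul_eq_mul]
    obtain rfl : b = 1 - a := by linarith
    nlinarith

theorem sub_le_pairing_sub_of_mem_convexHull {X Y : Type*} [NormedAddCommGroup X] [NormedSpace ℝ X]
    [NormedAddCommGroup Y] [NormedSpace ℝ Y] (J : Y →L[ℝ] StrongDual ℝ X) {G : Set (X × Y)}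
    (hG : ∀ p ∈ G, ∀ q ∈ G, 0 ≤ J (p.2 - q.2) (p.1 - q.1)) {p : X × Y} (hp : p ∈ G)
    {z : X × Y × ℝ} (hz : z ∈ convexHull ℝ ((fun p : X × Y => (p.1, p.2, J p.2 p.1)) '' G)) :
    J p.2 z.1 + J z.2.1 p.1 ≤ z.2.2 + J p.2 p.1 := by
  refine pairing_le_of_mem_convexHull J (fun q hq => ?_) hz
  have := hG p hp q hq
  simp only [map_sub, sub_apply] at this
  linarith

/-- The monotonicity inequality is affine in each of its two points separately, so it passes to the
hull in one variable and then in the other; here both are `z`. -/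
theorem pairing_le_snd_of_mem_convexHull {X Y : Type*} [NormedAddCommGroup X] [NormedSpace ℝ X]
    [NormedAddCommGroup Y] [NormedSpace ℝ Y] (J : Y →L[ℝ] StrongDual ℝ X) {G : Set (X × Y)}
    (hG : ∀ p ∈ G, ∀ q ∈ G, 0 ≤ J (p.2 - q.2) (p.1 - q.1))
    {z : X × Y × ℝ} (hz : z ∈ convexHull ℝ ((fun p : X × Y => (p.1, p.2, J p.2 p.1)) '' G)) :
    J z.2.1 z.1 ≤ z.2.2 := by
  have := pairing_le_of_mem_convexHull J (x := z.1) (y := z.2.1) (c := z.2.2)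
    (fun p hp => by linarith [sub_le_pairing_sub_of_mem_convexHull J hG hp hz]) hz
  linarith

/-! ### Fenchel duality -/

/-- A functional `η` attains `½‖η‖²` as the supremum of `η u - ½‖u‖²`. -/
theorem half_sq_norm_le_of_forall {X : Type*} [NormedAddCommGroup X] [NormedSpace ℝ X]
    (η : StrongDual ℝ X) {c : ℝ} (h : ∀ u, η u - 1 / 2 * ‖u‖ ^ 2 ≤ c) :
    1 / 2 * ‖η‖ ^ 2 ≤ c := by
  have hc : 0 ≤ c := by simpa using h 0
  have hbound : ‖η‖ ≤ √(2 * c) := by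
    refine η.opNorm_le_bound (Real.sqrt_nonneg _) fun u => ?_
    refine le_of_sq_le_sq ?_ (by positivity)
    rw [mul_pow, Real.sq_sqrt (by linarith), Real.norm_eq_abs, sq_abs]
    rcases eq_or_ne u 0 with rfl | hu
    · simp
    have hu : 0 < ‖u‖ ^ 2 := by positivity
    have := h ((η u / ‖u‖ ^ 2) • u)
    rw [map_smul, norm_smul, smul_eq_mul, mul_pow, Real.norm_eq_abs, sq_abs] at this
    have h2 : η u / ‖u‖ ^ 2 * η u - 1 / 2 * ((η u / ‖u‖ ^ 2) ^ 2 * ‖u‖ ^ 2)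
        = (η u) ^ 2 / (2 * ‖u‖ ^ 2) := by field_simp; ring
    rw [h2, div_le_iff₀ (by positivity)] at this
    linarith
  have := pow_le_pow_left₀ (norm_nonneg η) hbound 2
  rw [Real.sq_sqrt (by linarith)] at this
  linarith

theorem convexOn_half_sq_norm (Z : Type*) [NormedAddCommGroup Z] [NormedSpace ℝ Z] :
    ConvexOn ℝ univ fun x : Z => 1 / 2 * ‖x‖ ^ 2 :=
  ((convexOn_norm convex_univ).pow (fun _ _ => norm_nonneg _) 2).smul (by norm_num)

/-- Fenchel duality for the convex hull of the pairing restricted to `G`, the support function of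
`W` and the squared norms: the primal infimum is at most `0`. Here `m x` is a minimizer of the
pairing with `x` over `W`. -/
theorem exists_mem_convexHull_le {X Y : Type*} [NormedAddCommGroup X] [NormedSpace ℝ X]
    [NormedAddCommGroup Y] [NormedSpace ℝ Y] (J : Y →L[ℝ] StrongDual ℝ X) {G : Set (X × Y)}
    {W : Set Y} (hW : Convex ℝ W)
    (hcomp : IsCompact ((fun v => StrongDual.toWeakDual (J v)) '' W))
    {m : X → Y} (hmW : ∀ x, m x ∈ W) (hmin : ∀ x, ∀ v ∈ W, J (m x) x ≤ J v x)
    {M : ℝ} (hM : ∀ v ∈ W, ‖J v‖ ≤ M)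
    (hG : ∀ (ξ : StrongDual ℝ X) (η : StrongDual ℝ Y) (v : Y), ∀ ε > 0, ∃ p ∈ G,
      J p.2 p.1 + ξ p.1 + η p.2 - η v ≤ ‖ξ + J v‖ * ‖η‖ + ε)
    {ε : ℝ} (hε : 0 < ε) :
    ∃ z ∈ convexHull ℝ ((fun p : X × Y => (p.1, p.2, J p.2 p.1)) '' G), ∃ v ∈ W,
      z.2.2 - J (m z.1) z.1 + 1 / 2 * ‖z.1‖ ^ 2 + 1 / 2 * ‖z.2.1 - v‖ ^ 2 ≤ ε := by
  by_contra! hcon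
  set C := convexHull ℝ ((fun p : X × Y => (p.1, p.2, J p.2 p.1)) '' G) with hC
  set A : Set (X × Y × ℝ) := {z | ∃ v ∈ W, (z.1, z.2.1 + v, z.2.2) ∈ C} with hA
  set k : X × Y × ℝ → ℝ :=
    fun z => z.2.2 - J (m z.1) z.1 + 1 / 2 * ‖z.1‖ ^ 2 + 1 / 2 * ‖z.2.1‖ ^ 2 with hk
  have hAconv : Convex ℝ A := by
    rintro z ⟨v, hv, hz⟩ z' ⟨v', hv', hz'⟩ a b ha hb hab
    refine ⟨a • v + b • v', hW hv hv' ha hb hab, ?_⟩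
    convert convex_convexHull ℝ _ hz hz' ha hb hab using 1
    ext
    · simp
    · simp only [Prod.snd_add, Prod.smul_snd, Prod.fst_add, Prod.smul_fst, smul_add]
      abel
    · simp
  have hh : ConvexOn ℝ univ fun x => -J (m x) x := by
    refine ⟨convex_univ, fun x _ x' _ a b ha hb hab => ?_⟩
    have h1 := mul_le_mul_of_nonneg_left (hmin x _ (hmW (a • x + b • x'))) ha
    have h2 := mul_le_mul_of_nonneg_left (hmin x' _ (hmW (a • x + b • x'))) hb
    simp only [smul_eq_mul, map_add, map_smul] at h1 h2 ⊢
    linarith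
  have hkconv : ConvexOn ℝ univ k := by
    have h1 : ConvexOn ℝ univ fun z : X × Y × ℝ => z.2.2 :=
      (LinearMap.snd ℝ Y ℝ ∘ₗ LinearMap.snd ℝ X (Y × ℝ)).convexOn convex_univ
    have h2 := hh.comp_linearMap (LinearMap.fst ℝ X (Y × ℝ))
    have h3 := ((convexOn_half_sq_norm X).comp_linearMap (LinearMap.fst ℝ X (Y × ℝ)))
    have h4 := ((convexOn_half_sq_norm Y).comp_linearMap
      (LinearMap.fst ℝ Y ℝ ∘ₗ LinearMap.snd ℝ X (Y × ℝ)))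
    exact ((h1.add h2).add h3).add h4
  have hhcont : Continuous fun x => J (m x) x := by
    have key : ∀ x x', J (m x) x ≤ J (m x') x' + M * dist x x' := fun x x' => by
      have h1 := hmin x _ (hmW x')
      have h2 := (J (m x')).le_opNorm (x - x')
      have h3 := mul_le_mul_of_nonneg_right (hM _ (hmW x')) (norm_nonneg (x - x'))
      have h4 := le_abs_self (J (m x') (x - x'))
      rw [Real.norm_eq_abs] at h2
      rw [dist_eq_norm]
      rw [map_sub] at h2 h4
      linarith
    exact (LipschitzWith.of_le_add_mul' M key).continuous
  have hkcont : Continuous k := by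
    have := hhcont.comp (continuous_fst (X := X) (Y := Y × ℝ))
    exact (((by fun_prop : Continuous fun z : X × Y × ℝ => z.2.2).sub this).add
      (by fun_prop)).add (by fun_prop)
  have hBconv : Convex ℝ {z | k z < ε} := by simpa using hkconv.convex_lt ε
  have hBopen : IsOpen {z | k z < ε} := isOpen_lt hkcont continuous_const
  have hdisj : Disjoint {z | k z < ε} A := by
    rw [Set.disjoint_left]
    rintro ⟨x, u, r⟩ hz ⟨v, hv, hz'⟩
    have := hcon _ hz' v hv
    simp only [add_sub_cancel_right] at this
    exact absurd hz this.not_gt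
  -- Normalizing `f` by its last coefficient, once this is shown positive, gives the dual variables
  -- `ξ`, `η`.
  obtain ⟨f, α, hfB, hfA⟩ := geometric_hahn_banach_open hBconv hBopen hAconv hdisj
  have hGA : ∀ p ∈ G, ∀ v ∈ W, (p.1, p.2 - v, J p.2 p.1) ∈ A := fun p hp v hv =>
    ⟨v, hv, by simpa using! subset_convexHull ℝ _ (mem_image_of_mem _ hp)⟩
  have hsplit : ∀ x u r, f (x, u, r) = f (x, 0, 0) + f (0, u, 0) + r * f (0, 0, 1) :=
    fun x u r => by
      rw [← smul_eq_mul r, ← map_smul, ← map_add, ← map_add]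
      simp
  have hc : 0 < f (0, 0, 1) := by
    obtain ⟨p, hp, -⟩ := hG 0 0 0 1 one_pos
    have h1 := hfA _ (hGA p hp _ (hmW 0))
    set z : X × Y × ℝ := (p.1, p.2 - m 0, J p.2 p.1) with hz
    have hkz : ε ≤ k z := by
      by_contra! h
      exact Set.disjoint_left.1 hdisj h (hGA p hp _ (hmW 0))
    -- Lowering the real coordinate by `k z` reaches level `0 < ε`, so `f` must increase in that
    -- direction.
    have h2 := hfB (z.1, z.2.1, z.2.2 - k z) (by
      simp only [hk, mem_ofPred_eq]
      linarith)
    rw [show z = (z.1, z.2.1, z.2.2) from rfl, hsplit] at h1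
    rw [hsplit] at h2
    have h3 : 0 < k z * f (0, 0, 1) := by linarith
    exact pos_of_mul_pos_right h3 (by linarith)
  set c := f (0, 0, 1) with hcdef
  set ξ : StrongDual ℝ X := c⁻¹ • (f.comp (ContinuousLinearMap.inl ℝ X (Y × ℝ))) with hξ
  set η : StrongDual ℝ Y := c⁻¹ • (f.comp
    ((ContinuousLinearMap.inr ℝ X (Y × ℝ)).comp (ContinuousLinearMap.inl ℝ Y ℝ))) with hη
  have hf : ∀ x u r, c⁻¹ * f (x, u, r) = ξ x + η u + r := fun x u r => by
    have h1 : ξ x = c⁻¹ * f (x, 0, 0) := rfl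
    have h2 : η u = c⁻¹ * f (0, u, 0) := rfl
    rw [hsplit, h1, h2]
    field_simp
  have hlow : ∀ x u, ξ x + η u + (ε + J (m x) x - 1 / 2 * ‖x‖ ^ 2 - 1 / 2 * ‖u‖ ^ 2)
      ≤ c⁻¹ * α := fun x u => by
    suffices ∀ r < ε + J (m x) x - 1 / 2 * ‖x‖ ^ 2 - 1 / 2 * ‖u‖ ^ 2,
        r ≤ c⁻¹ * α - (ξ x + η u) by linarith [le_of_forall_lt_imp_le_of_dense this]
    intro r hr
    have h1 := hfB (x, u, r) (by
      simp only [hk, mem_ofPred_eq]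
      linarith)
    have h2 := mul_lt_mul_of_pos_left h1 (inv_pos.2 hc)
    rw [hf] at h2
    linarith
  have hη2 : ∀ x, 1 / 2 * ‖η‖ ^ 2 ≤ c⁻¹ * α - ε - (ξ x + J (m x) x - 1 / 2 * ‖x‖ ^ 2) := fun x =>
    half_sq_norm_le_of_forall η fun u => by linarith [hlow x u]
  obtain ⟨_, ⟨v, hv, rfl⟩, hle⟩ := exists_half_sq_norm_add_le (K := J '' W)
    (hW.linear_image J.toLinearMap) (by rwa [image_image]) ξ
    (β := c⁻¹ * α - ε - 1 / 2 * ‖η‖ ^ 2) (half_pos hε) fun x =>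
      ⟨_, mem_image_of_mem _ (hmW x), by rw [add_apply]; linarith [hη2 x]⟩
  -- By `ab ≤ ½a² + ½b²`, the functional at `p` is at most `c⁻¹α - ε/2 + ε/4`, against the
  -- separation bound `c⁻¹α`.
  obtain ⟨p, hp, hple⟩ := hG ξ η v (ε / 4) (by linarith)
  have h1 := mul_le_mul_of_nonneg_left (hfA _ (hGA p hp v hv)) (inv_pos.2 hc).le
  rw [hf, map_sub] at h1
  nlinarith [sq_nonneg (‖ξ + J v‖ - ‖η‖)]

/-! ### Points of the graph close to `{0} × W` -/

theorem pairing_le_norm_mul_norm {X Y : Type*} [NormedAddCommGroup X] [NormedSpace ℝ X]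
    [NormedAddCommGroup Y] [NormedSpace ℝ Y] {J : Y →L[ℝ] StrongDual ℝ X}
    (hJ : ∀ y, ‖J y‖ ≤ ‖y‖) (x : X) (y : Y) : |J y x| ≤ ‖y‖ * ‖x‖ :=
  (J y).le_of_opNorm_le (hJ y) x

/-- Eliminating `c` and completing squares gives `(a - C)² + (b - C)² ≤ 4C² + 2ε`. -/
theorem le_of_half_sq_add_le {a b c C ε : ℝ} (hC : 0 ≤ C) (hε : ε ≤ 1)
    (h₁ : 1 / 2 * a ^ 2 + 1 / 2 * b ^ 2 + c ≤ ε) (h₂ : 0 ≤ c + C * (a + b) + C ^ 2) :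
    a ≤ 3 * C + 2 := by
  by_contra! h
  nlinarith [sq_nonneg (b - C)]

/-- If the pairing of every point of `G` with the origin is nonnegative for some `v ∈ W`, then `G`
comes arbitrarily close to `{0} × W`. -/
theorem exists_mem_norm_le {X Y : Type*} [NormedAddCommGroup X] [NormedSpace ℝ X]
    [NormedAddCommGroup Y] [NormedSpace ℝ Y] (J : Y →L[ℝ] StrongDual ℝ X)
    (hJ : ∀ y, ‖J y‖ ≤ ‖y‖) {G : Set (X × Y)}
    (hmono : ∀ p ∈ G, ∀ q ∈ G, 0 ≤ J (p.2 - q.2) (p.1 - q.1))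
    (hqd : ∀ (x : X) (y : Y), ∀ ε > 0, ∃ p ∈ G,
      1 / 2 * ‖p.1 - x‖ ^ 2 + 1 / 2 * ‖p.2 - y‖ ^ 2 + J (p.2 - y) (p.1 - x) ≤ ε)
    {W : Set Y} (hW : Convex ℝ W)
    (hcomp : IsCompact ((fun v => StrongDual.toWeakDual (J v)) '' W))
    {m : X → Y} (hmW : ∀ x, m x ∈ W) (hmin : ∀ x, ∀ v ∈ W, J (m x) x ≤ J v x)
    {M : ℝ} (hM : ∀ v ∈ W, ‖J v‖ ≤ M)
    (hG : ∀ (ξ : StrongDual ℝ X) (η : StrongDual ℝ Y) (v : Y), ∀ ε > 0, ∃ p ∈ G,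
      J p.2 p.1 + ξ p.1 + η p.2 - η v ≤ ‖ξ + J v‖ * ‖η‖ + ε)
    (hGW : ∀ p ∈ G, ∃ v ∈ W, 0 ≤ J (p.2 - v) p.1) {δ : ℝ} (hδ : 0 < δ) :
    ∃ p ∈ G, ∃ v ∈ W, ‖p.1‖ ≤ δ ∧ ‖p.2 - v‖ ≤ δ := by
  have hM0 : 0 ≤ M := (norm_nonneg _).trans (hM _ (hmW 0))
  have hMb : ∀ v ∈ W, ∀ x, |J v x| ≤ M * ‖x‖ := fun v hv x =>
    (J v).le_of_opNorm_le (hM v hv) x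
  have hJb := pairing_le_norm_mul_norm hJ
  obtain ⟨⟨s₀, t₀⟩, hp₀, -⟩ := hqd 0 0 1 one_pos
  set P := 1 + ‖s₀‖ with hP
  set Q := M + 1 + ‖t₀‖ with hQ
  have hP1 : 0 ≤ ‖s₀‖ := norm_nonneg _
  have hQ1 : 0 ≤ ‖t₀‖ := norm_nonneg _
  set R := 3 * (P + Q) + 2 with hR
  set L := 3 + 2 * M + 2 * R with hL
  have hRpos : 0 < R := by linarith
  have hLpos : 0 < L := by linarith
  set d := min 1 (min (δ / 2) (δ ^ 2 / (8 * L))) with hd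
  have hdpos : 0 < d := by positivity
  have hd1 : d ≤ 1 := min_le_left _ _
  have hd2 : d ≤ δ / 2 := (min_le_right _ _).trans (min_le_left _ _)
  have hd3 : 2 * (d * L) ≤ (δ / 2) ^ 2 := by
    have : d ≤ δ ^ 2 / (8 * L) := (min_le_right _ _).trans (min_le_right _ _)
    rw [le_div_iff₀ (by positivity)] at this
    linarith
  have hdd : d ^ 2 ≤ d := by nlinarith
  set ε := d ^ 2 / 4 with hε
  have hεpos : 0 < ε := by positivity
  obtain ⟨⟨x, t, ρ⟩, hz, v, hv, hle⟩ :=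
    exists_mem_convexHull_le J hW hcomp hmW hmin hM hG hεpos
  obtain ⟨p, hp, hple⟩ := hqd x t ε hεpos
  have hρ := pairing_le_snd_of_mem_convexHull J hmono hz
  have hpz := sub_le_pairing_sub_of_mem_convexHull J hmono hp hz
  obtain ⟨u, rfl⟩ : ∃ u, t = u + v := ⟨t - v, by simp⟩
  obtain ⟨⟨s, s'⟩, hps⟩ : ∃ q : X × Y, p = (x + q.1, u + v + q.2) :=
    ⟨(p.1 - x, p.2 - (u + v)), by simp⟩
  subst hps
  simp only [add_sub_cancel_right, add_sub_cancel_left, map_add, add_apply] at hle hple hρ hpz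
  have hvx := hmin x v hv
  have hux := abs_le.1 (hJb x u)
  have hsq := sq_nonneg (‖x‖ - ‖u‖)
  -- By `hpz`, `-J s' s ≤ ρ - J (u + v) x`, which `hle` bounds by `ε`; hence `½‖s‖² + ½‖s'‖² ≤ 2ε =
  -- d²/2`.
  have hss : ‖s‖ ^ 2 ≤ d ^ 2 ∧ ‖s'‖ ^ 2 ≤ d ^ 2 := by
    constructor <;> nlinarith [sq_nonneg ‖s‖, sq_nonneg ‖s'‖]
  have hs : ‖s‖ ≤ d := le_of_sq_le_sq hss.1 hdpos.le
  have hs' : ‖s'‖ ≤ d := le_of_sq_le_sq hss.2 hdpos.le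
  have hb : 1 / 2 * ‖x‖ ^ 2 + 1 / 2 * ‖u‖ ^ 2 + J u x ≤ ε := by linarith
  have hx0 := norm_nonneg x
  have hu0 := norm_nonneg u
  -- Monotonicity against the fixed point `(s₀, t₀)` bounds `J u x` below linearly in the norms, so
  -- `x` and `u` stay within a radius `R` independent of `δ`.
  have hbelow : 0 ≤ J u x + (P + Q) * (‖x‖ + ‖u‖) + (P + Q) ^ 2 := by
    have h1 := hmono _ hp _ hp₀
    have hexp : J (u + v + s' - t₀) (x + s - s₀)
        = J u x + J u (s - s₀) + J v (x + s - s₀) + J (s' - t₀) (x + s - s₀) := by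
      simp only [map_add, map_sub, add_apply, sub_apply]
      ring
    have n1 : ‖s - s₀‖ ≤ P := (norm_sub_le _ _).trans (by linarith)
    have n2 : ‖x + s - s₀‖ ≤ ‖x‖ + P := by
      rw [add_sub_assoc]
      exact (norm_add_le _ _).trans (by linarith)
    have n3 : ‖s' - t₀‖ ≤ 1 + ‖t₀‖ := (norm_sub_le _ _).trans (by linarith)
    have e1 : J u (s - s₀) ≤ ‖u‖ * P := (le_abs_self _).trans ((hJb _ _).trans (by gcongr))
    have e2 : J v (x + s - s₀) ≤ M * (‖x‖ + P) :=
      (le_abs_self _).trans ((hMb v hv _).trans (by gcongr))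
    have e3 : J (s' - t₀) (x + s - s₀) ≤ (1 + ‖t₀‖) * (‖x‖ + P) :=
      (le_abs_self _).trans ((hJb _ _).trans (by gcongr))
    simp only [hexp] at h1
    have hPpos : 0 ≤ P := by linarith
    have hQpos : 0 ≤ Q := by linarith
    have e4 : (1 + ‖t₀‖) * (‖x‖ + P) + M * (‖x‖ + P) = Q * (‖x‖ + P) := by rw [hQ]; ring
    have e5 : 0 ≤ P * ‖x‖ + Q * ‖u‖ + (P ^ 2 + Q ^ 2 + P * Q) := by positivity
    linarith
  have hxR : ‖x‖ ≤ R := le_of_half_sq_add_le (by linarith) (by linarith) hb hbelow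
  have huR : ‖u‖ ≤ R := le_of_half_sq_add_le (by linarith) (by linarith)
    (by linarith : 1 / 2 * ‖u‖ ^ 2 + 1 / 2 * ‖x‖ ^ 2 + J u x ≤ ε) (by linarith)
  -- By `hρ` and `hle`, `v` minimizes the pairing with `x` over `W` up to `ε`, so it can replace the
  -- `v₁` supplied by `hGW`.
  have hbL : -(d * (2 + 2 * M + 2 * R)) ≤ J u x := by
    obtain ⟨v₁, hv₁, h1⟩ := hGW _ hp
    have h2 := hmin x v₁ hv₁
    simp only [map_add, map_sub, add_apply, sub_apply] at h1
    have e1 : |J v₁ s| ≤ M * d := (hMb _ hv₁ _).trans (by gcongr)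
    have e2 : |J v s| ≤ M * d := (hMb _ hv _).trans (by gcongr)
    have e3 : |J u s| ≤ R * d := (hJb _ _).trans (by gcongr)
    have e4 : |J s' x| ≤ d * R := (hJb _ _).trans (by gcongr)
    have e5 : |J s' s| ≤ d * d := (hJb _ _).trans (by gcongr)
    have := (abs_le.1 e1).1
    have := (abs_le.1 e2).2
    have := (abs_le.1 e3).2
    have := (abs_le.1 e4).2
    have := (abs_le.1 e5).2
    linarith
  have hsmall : ‖x‖ ^ 2 + ‖u‖ ^ 2 ≤ (δ / 2) ^ 2 := by
    have : d * L = d * (2 + 2 * M + 2 * R) + d := by rw [hL]; ring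
    linarith
  have hxδ : ‖x‖ ≤ δ / 2 := le_of_sq_le_sq (by linarith [sq_nonneg ‖u‖]) (by linarith)
  have huδ : ‖u‖ ≤ δ / 2 := le_of_sq_le_sq (by linarith [sq_nonneg ‖x‖]) (by linarith)
  refine ⟨_, hp, v, hv, (norm_add_le _ _).trans (by linarith), ?_⟩
  rw [show u + v + s' - v = u + s' by abel]
  exact (norm_add_le _ _).trans (by linarith)

/-! ### Passage to the weak* limit -/

/-- Some point of `{0} × W` is monotonically related to `G`. -/
theorem exists_mem_forall_pairing_nonneg {X Y : Type*} [NormedAddCommGroup X] [NormedSpace ℝ X]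
    [CompleteSpace X] [NormedAddCommGroup Y] [NormedSpace ℝ Y] (J : Y →L[ℝ] StrongDual ℝ X)
    (hJ : ∀ y, ‖J y‖ ≤ ‖y‖) {G : Set (X × Y)}
    (hmono : ∀ p ∈ G, ∀ q ∈ G, 0 ≤ J (p.2 - q.2) (p.1 - q.1))
    (hqd : ∀ (x : X) (y : Y), ∀ ε > 0, ∃ p ∈ G,
      1 / 2 * ‖p.1 - x‖ ^ 2 + 1 / 2 * ‖p.2 - y‖ ^ 2 + J (p.2 - y) (p.1 - x) ≤ ε)
    {W : Set Y} (hne : W.Nonempty) (hW : Convex ℝ W)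
    (hcomp : IsCompact ((fun v => StrongDual.toWeakDual (J v)) '' W))
    (hG : ∀ (ξ : StrongDual ℝ X) (η : StrongDual ℝ Y) (v : Y), ∀ ε > 0, ∃ p ∈ G,
      J p.2 p.1 + ξ p.1 + η p.2 - η v ≤ ‖ξ + J v‖ * ‖η‖ + ε)
    (hGW : ∀ p ∈ G, ∃ v ∈ W, 0 ≤ J (p.2 - v) p.1) :
    ∃ v ∈ W, ∀ p ∈ G, 0 ≤ J (p.2 - v) p.1 := by
  have hexmin : ∀ x : X, ∃ v ∈ W, ∀ v' ∈ W, J v x ≤ J v' x := fun x => by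
    obtain ⟨_, ⟨v, hv, rfl⟩, h⟩ := hcomp.exists_isMinOn (hne.image _)
      (WeakDual.eval_continuous x).continuousOn
    exact ⟨v, hv, fun v' hv' => h (mem_image_of_mem _ hv')⟩
  choose m hmW hmin using hexmin
  obtain ⟨M, hM⟩ : ∃ M, ∀ v ∈ W, ‖J v‖ ≤ M := by
    obtain ⟨M, hM⟩ := banach_steinhaus (g := fun v : W => J v) fun x => by
      obtain ⟨c, hc⟩ := (hcomp.image (WeakDual.eval_continuous x)).isBounded.exists_norm_le
      exact ⟨c, fun v => hc _ (mem_image_of_mem _ (mem_image_of_mem _ v.2))⟩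
    exact ⟨M, fun v hv => hM ⟨v, hv⟩⟩
  have hnear := fun n : ℕ => exists_mem_norm_le J hJ hmono hqd hW hcomp hmW hmin hM hG hGW
    (Nat.one_div_pos_of_nat (α := ℝ) (n := n))
  choose p hp v hv hp1 hp2 using hnear
  have hM0 : 0 ≤ M := (norm_nonneg _).trans (hM _ (hv 0))
  -- An ultrafilter replaces subsequences, since weak* compactness need not be sequential.
  obtain ⟨_, ⟨v₀, hv₀, rfl⟩, hlim⟩ := hcomp.ultrafilter_le_nhds
    ((hyperfilter ℕ).map fun n => StrongDual.toWeakDual (J (v n)))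
    (by
      rw [le_principal_iff]
      exact Filter.mem_map.2 (univ_mem' fun n => mem_image_of_mem _ (hv n)))
  refine ⟨v₀, hv₀, fun q hq => ?_⟩
  have hJv : Tendsto (fun n => J (v n) q.1) (hyperfilter ℕ) (𝓝 (J v₀ q.1)) :=
    ((WeakDual.eval_continuous q.1).tendsto _).comp hlim
  have h0 : Tendsto (fun n : ℕ => 1 / ((n : ℝ) + 1)) (hyperfilter ℕ) (𝓝 0) :=
    tendsto_one_div_add_atTop_nhds_zero_nat.mono_left Nat.hyperfilter_le_atTop
  have hr : Tendsto (fun n : ℕ => J q.2 q.1 - J (v n) q.1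
      + ((M + ‖q.2‖) * (1 / ((n : ℝ) + 1))
        + 1 / ((n : ℝ) + 1) * (1 / ((n : ℝ) + 1) + ‖q.1‖)))
      (hyperfilter ℕ) (𝓝 (J q.2 q.1 - J v₀ q.1 + ((M + ‖q.2‖) * 0 + 0 * (0 + ‖q.1‖)))) :=
    (tendsto_const_nhds.sub hJv).add
      ((tendsto_const_nhds.mul h0).add (h0.mul (h0.add tendsto_const_nhds)))
  have hge := ge_of_tendsto' hr (b := 0) fun n => by
    have h1 := hmono _ (hp n) q hq
    have hexp : J ((p n).2 - q.2) ((p n).1 - q.1) = J q.2 q.1 - J (v n) q.1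
        + (J (v n) (p n).1 - J q.2 (p n).1 + J ((p n).2 - v n) ((p n).1 - q.1)) := by
      simp only [map_sub, sub_apply]
      ring
    have e1 : J (v n) (p n).1 ≤ M * (1 / ((n : ℝ) + 1)) :=
      (le_abs_self _).trans (((J (v n)).le_of_opNorm_le (hM _ (hv n)) _).trans
        (by gcongr; exact hp1 n))
    have e2 : -(J q.2 (p n).1) ≤ ‖q.2‖ * (1 / ((n : ℝ) + 1)) :=
      (neg_le_abs _).trans ((pairing_le_norm_mul_norm hJ _ _).trans (by gcongr; exact hp1 n))
    have e3 : J ((p n).2 - v n) ((p n).1 - q.1)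
        ≤ 1 / ((n : ℝ) + 1) * (1 / ((n : ℝ) + 1) + ‖q.1‖) := by
      refine (le_abs_self _).trans ((pairing_le_norm_mul_norm hJ _ _).trans ?_)
      have := (norm_sub_le (p n).1 q.1).trans (add_le_add_left (hp1 n) _)
      gcongr
      exact hp2 n
    rw [hexp] at h1
    linarith
  simpa using hge

/-! ### Quasidense multifunctions and the two cases -/

namespace Multifunction

variable {E : Type*} [NormedAddCommGroup E] [NormedSpace ℝ E] {S : E → Set (StrongDual ℝ E)}

theorem IsQuasidense.exists_le (hqd : IsQuasidense S) (x : E) (x' : StrongDual ℝ E) {ε : ℝ}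
    (hε : 0 < ε) : ∃ p ∈ graph S,
      1 / 2 * ‖p.1 - x‖ ^ 2 + 1 / 2 * ‖p.2 - x'‖ ^ 2 + (p.2 - x') (p.1 - x) ≤ ε := by
  have h := (hqd x x').trans_lt (EReal.coe_pos.2 hε)
  simp only [iInf_lt_iff] at h
  obtain ⟨p, hp, hlt⟩ := h
  exact ⟨p, hp, (EReal.coe_lt_coe_iff.1 hlt).le⟩

/-- A quasidense multifunction is of negative infimum type. -/
theorem IsQuasidense.exists_bidual_le (hqd : IsQuasidense S) (y' : StrongDual ℝ E)
    (y'' : StrongDual ℝ (StrongDual ℝ E)) {ε : ℝ} (hε : 0 < ε) :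
    ∃ p ∈ graph S, p.2 p.1 - y' p.1 - y'' p.2 + y'' y' ≤ ε := by
  obtain ⟨z, hz⟩ : ∃ z, 1 / 2 * ‖y''‖ ^ 2 - ε / 2 ≤ y'' z - 1 / 2 * ‖z‖ ^ 2 := by
    by_contra! h
    linarith [half_sq_norm_le_of_forall y'' fun u => (h u).le]
  -- Centring at `y' + z` leaves the errors `z s` and `-y'' a`, absorbed by the squares; the
  -- near-optimality of `z` cancels the rest.
  obtain ⟨⟨s, s'⟩, hp, hle⟩ := hqd.exists_le 0 (y' + z) (half_pos hε)
  refine ⟨_, hp, ?_⟩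
  obtain ⟨a, rfl⟩ : ∃ a, s' = a + (y' + z) := ⟨s' - (y' + z), by simp⟩
  simp only [add_sub_cancel_right, sub_zero, map_add, add_apply] at hle ⊢
  have h1 : z s ≤ ‖z‖ * ‖s‖ := (le_abs_self _).trans (z.le_opNorm s)
  have h2 : -y'' a ≤ ‖y''‖ * ‖a‖ := (neg_le_abs _).trans (y''.le_opNorm a)
  linarith [sq_nonneg (‖z‖ - ‖s‖), sq_nonneg (‖y''‖ - ‖a‖)]

/-- A point monotonically related to a closed quasidense graph belongs to it. -/
theorem IsQuasidense.mem_graph (hqd : IsQuasidense S) (hclosed : IsClosedGraph S) {w : E}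
    {w' : StrongDual ℝ E} (h : ∀ p ∈ graph S, 0 ≤ (p.2 - w') (p.1 - w)) : (w, w') ∈ graph S := by
  refine hclosed.closure_subset (Metric.mem_closure_iff.2 fun δ hδ => ?_)
  obtain ⟨p, hp, hle⟩ := hqd.exists_le w w' (show 0 < (δ / 2) ^ 2 / 2 by positivity)
  have hp0 := h p hp
  refine ⟨p, hp, ?_⟩
  rw [dist_comm, Prod.dist_eq, dist_eq_norm, dist_eq_norm]
  have h1 : ‖p.1 - w‖ ≤ δ / 2 :=
    le_of_sq_le_sq (by linarith [sq_nonneg ‖p.2 - w'‖]) (by linarith)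
  have h2 : ‖p.2 - w'‖ ≤ δ / 2 :=
    le_of_sq_le_sq (by linarith [sq_nonneg ‖p.1 - w‖]) (by linarith)
  exact max_lt (by linarith) (by linarith)

theorem nonempty_inter_of_weakDual_isCompact [CompleteSpace E] (hclosed : IsClosedGraph S)
    (hmono : IsMonotone S) (hqd : IsQuasidense S) {w : E} {W' : Set (StrongDual ℝ E)}
    (hne : W'.Nonempty) (hconv : Convex ℝ W') (hcomp : IsCompact (StrongDual.toWeakDual '' W'))
    (h : ∀ p ∈ graph S, ∃ v' ∈ W', 0 ≤ (p.2 - v') (p.1 - w)) : (S w ∩ W').Nonempty := by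
  obtain ⟨v', hv', hrel⟩ := exists_mem_forall_pairing_nonneg
    (ContinuousLinearMap.id ℝ (StrongDual ℝ E)) (fun y => le_rfl)
    (G := {p | (p.1 + w, p.2) ∈ graph S}) (W := W')
    (fun p hp q hq => by simpa using hmono _ hp _ hq)
    (fun x x' ε hε => by
      obtain ⟨p, hp, hle⟩ := hqd.exists_le (x + w) x' hε
      exact ⟨(p.1 - w, p.2), by simpa using hp, by
        simpa [sub_sub, add_comm w x] using hle⟩)
    hne hconv hcomp
    (fun ξ η v ε hε => by
      -- The summand from `w` accounts for the translation; what remains is `-η (ξ + v) ≤ ‖η‖ ‖ξ +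
      -- v‖`.
      obtain ⟨p, hp, hle⟩ := hqd.exists_bidual_le (-ξ)
        (-η + NormedSpace.inclusionInDoubleDual ℝ E w) hε
      refine ⟨(p.1 - w, p.2), by simpa using hp, ?_⟩
      have hn := (neg_le_abs _).trans (η.le_opNorm (ξ + v))
      simp only [add_apply, neg_apply, map_neg, NormedSpace.dual_def, map_add] at hle hn
      simp only [ContinuousLinearMap.id_apply, map_sub]
      linarith)
    (fun p hp => by simpa using h _ hp)
  refine ⟨v', hqd.mem_graph hclosed fun p hp => ?_, hv'⟩
  exact hrel (p.1 - w, p.2) (by simpa using hp)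

theorem mem_iUnion_of_weakSpace_isCompact (hclosed : IsClosedGraph S)
    (hmono : IsMonotone S) (hqd : IsQuasidense S) {W : Set E} {w' : StrongDual ℝ E}
    (hne : W.Nonempty) (hconv : Convex ℝ W) (hcomp : IsCompact (toWeakSpace ℝ E '' W))
    (h : ∀ p ∈ graph S, ∃ v ∈ W, 0 ≤ (p.2 - w') (p.1 - v)) : w' ∈ ⋃ v ∈ W, S v := by
  obtain ⟨v, hv, hrel⟩ := exists_mem_forall_pairing_nonneg
    (NormedSpace.inclusionInDoubleDual ℝ E) (NormedSpace.double_dual_bound ℝ E)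
    (G := {p | (p.2, p.1 + w') ∈ graph S}) (W := W)
    (fun p hp q hq => by
      have := hmono _ hp _ hq
      simpa only [NormedSpace.dual_def, add_sub_add_right_eq_sub] using this)
    (fun x' x ε hε => by
      obtain ⟨p, hp, hle⟩ := hqd.exists_le x (x' + w') hε
      refine ⟨(p.2 - w', p.1), by simpa using hp, ?_⟩
      rw [NormedSpace.dual_def]
      simp only [sub_sub, add_comm w' x']
      linarith)
    hne hconv
    (by
      have := hcomp.image (NormedSpace.inclusionInDoubleDualWeak ℝ E).continuous
      rwa [image_image] at this)
    (fun ξ η v ε hε => by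
      obtain ⟨p, hp, hle⟩ := hqd.exists_bidual_le (-η + w') (-ξ) hε
      refine ⟨(p.2 - w', p.1), by simpa using hp, ?_⟩
      have hn := (neg_le_abs _).trans
        ((ξ + NormedSpace.inclusionInDoubleDual ℝ E v).le_opNorm η)
      simp only [add_apply, neg_apply, map_neg, NormedSpace.dual_def, map_add] at hle hn
      simp only [NormedSpace.dual_def, map_sub]
      linarith)
    (fun p hp => by
      obtain ⟨v, hv, h0⟩ := h _ hp
      exact ⟨v, hv, by simpa only [NormedSpace.dual_def, add_sub_cancel_right] using h0⟩)
  refine mem_iUnion₂.2 ⟨v, hv, hqd.mem_graph hclosed fun p hp => ?_⟩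
  have := hrel (p.2 - w', p.1) (by simpa using hp)
  simpa only [NormedSpace.dual_def] using this

end Multifunction

theorem mainTheorem3 {E : Type*} [NormedAddCommGroup E] [NormedSpace ℝ E] [CompleteSpace E]
    [Nontrivial E] (S : E → Set (StrongDual ℝ E))
    (hclosed : Multifunction.IsClosedGraph S) (hmono : Multifunction.IsMonotone S)
    (hqd : Multifunction.IsQuasidense S) :
    (∀ (w : E) (W' : Set (StrongDual ℝ E)), W'.Nonempty → Convex ℝ W' →
      IsCompact (StrongDual.toWeakDual '' W') →
      (∀ p ∈ Multifunction.graph S,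
        ∃ m : ℝ, IsGreatest ((fun v' : StrongDual ℝ E => (p.2 - v') (p.1 - w)) '' W') m ∧ 0 ≤ m) →
      (S w ∩ W').Nonempty) ∧
    (∀ (W : Set E) (w' : StrongDual ℝ E), W.Nonempty → Convex ℝ W →
      IsCompact (toWeakSpace ℝ E '' W) →
      (∀ p ∈ Multifunction.graph S,
        ∃ m : ℝ, IsGreatest ((fun v : E => (p.2 - w') (p.1 - v)) '' W) m ∧ 0 ≤ m) →
      w' ∈ ⋃ v ∈ W, S v) := by
  refine ⟨fun w W' hne hconv hcomp h => ?_, fun W w' hne hconv hcomp h => ?_⟩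
  · refine Multifunction.nonempty_inter_of_weakDual_isCompact hclosed hmono hqd hne hconv hcomp
      fun p hp => ?_
    obtain ⟨_, ⟨⟨v', hv', rfl⟩, -⟩, h0⟩ := h p hp
    exact ⟨v', hv', h0⟩
  · refine Multifunction.mem_iUnion_of_weakSpace_isCompact hclosed hmono hqd hne hconv hcomp
      fun p hp => ?_
    obtain ⟨_, ⟨⟨v, hv, rfl⟩, -⟩, h0⟩ := h p hp
    exact ⟨v, hv, h0⟩
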